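/- Let $G(a,b)=\left(\dfrac{5a+5b+ab+9}{(a+b+2)^{4/3}},\ \dfrac{a+b+6}{(a+b+2)^{2/3}}\right)$ for $(a,b)\in\mathbb{R}^2$ with $a+b+2\neq0$ (real cube roots). Let $R(a,b)=-a^2b^2+4a^3+4b^3-18ab+27$, let $L_2$ be the connected component of the curve $\{R=0\}$ that contains $(-1,-1)$ (the other component contains $(3,3)$), let $C_1$ be the connected component of $\mathbb{R}^2\setminus\{R=0\}$ that lies below $L_2$ (the one containing $(-2,-2)$), and let $R_1=\{a=b\}$. With $A=172+12\sqrt{177}$, let $$P_2=\Big(\tfrac{-43+3\sqrt{177}}{384}A^{2/3}-\tfrac16A^{1/3}-\tfrac83,\ \tfrac{13-\sqrt{177}}{48}A^{2/3}+\tfrac{7+\sqrt{177}}{48}A^{1/3}+\tfrac43\Big)\simeq(-4.20557,\,3.95774)$$ be the saddle fixed point of $G$. Let $W^s(P_2)$ be the set of points all of whose iterates $G^n(a,b)$ are defined and which satisfy $\lim_{n\to\infty}G^n(a,b)=P_2$. For a neighbourhood $V$ of $P_2$, let the local stable manifold $W^s_{\mathrm{loc}}(P_2)$ in $V$ be the set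 of points of $W^s(P_2)$ whose whole forward orbit (including the point itself) lies in $V$. Then $$W^s(P_2)=\big(L_2\cup\{(a,b):\exists\,n\ge0,\ G^n(a,b)\text{ is defined and } G^n(a,b)\in R_1\cap C_1\}\big)\setminus\{(a,b):\exists\,n\ge0,\ G^n(a,b)\text{ is defined and } G^n(a,b)=(-1,-1)\}.$$ Moreover, for every sufficiently small neighbourhood $V$ of $P_2$, the local stable manifold $W^s_{\mathrm{loc}}(P_2)$ in $V$ is contained in $L_2$. -/

import Mathlib

open Filter Topology

namespace Landen

noncomputable section

/-- The real cube root, on the whole real line. -/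
def cbrt (x : ℝ) : ℝ := Real.sign x * |x| ^ ((1 : ℝ) / 3)

theorem cbrt_pow_three (x : ℝ) : cbrt x ^ 3 = x := by
  have h : (|x| ^ ((1 : ℝ) / 3)) ^ 3 = |x| := by
    rw [← Real.rpow_natCast, ← Real.rpow_mul (abs_nonneg x)]
    norm_num
  unfold cbrt
  rw [mul_pow, h]
  rcases lt_trichotomy x 0 with hx | hx | hx
  · rw [Real.sign_of_neg hx, abs_of_neg hx]; ring
  · subst hx; simp
  · rw [Real.sign_of_pos hx, abs_of_pos hx]; ring

/-- The points at which the formula of the map `G` makes sense. -/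
def domainG : Set (ℝ × ℝ) := {p | p.1 + p.2 + 2 ≠ 0}

/-- The map `G(a,b) = ((5a+5b+ab+9)/(a+b+2)^{4/3}, (a+b+6)/(a+b+2)^{2/3})`. Its values outside
`domainG` carry no meaning; every notion below asks for the iterates to be defined. -/
def G (p : ℝ × ℝ) : ℝ × ℝ :=
  ((5 * p.1 + 5 * p.2 + p.1 * p.2 + 9) / cbrt (p.1 + p.2 + 2) ^ 4,
    (p.1 + p.2 + 6) / cbrt (p.1 + p.2 + 2) ^ 2)

/-- The `n`-th iterate of `p` under the partially defined map `G` exists. -/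
def IterateDefined (n : ℕ) (p : ℝ × ℝ) : Prop := ∀ k < n, G^[k] p ∈ domainG

/-- The points that have an `n`-th iterate in `S` for some `n ≥ 0`. -/
def landsIn (S : Set (ℝ × ℝ)) : Set (ℝ × ℝ) := {p | ∃ n : ℕ, IterateDefined n p ∧ G^[n] p ∈ S}

/-- The stable set of `P`: all iterates exist and they converge to `P`. -/
def stableSet (P : ℝ × ℝ) : Set (ℝ × ℝ) :=
  {p | (∀ n : ℕ, IterateDefined n p) ∧ Tendsto (fun n : ℕ => G^[n] p) atTop (𝓝 P)}

/-- The local stable manifold of `P` with respect to the neighbourhood `V` of `P`: the points of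
the stable set whose whole forward orbit stays in `V`. -/
def localStableManifold (P : ℝ × ℝ) (V : Set (ℝ × ℝ)) : Set (ℝ × ℝ) :=
  {p | p ∈ stableSet P ∧ ∀ n : ℕ, G^[n] p ∈ V}

/-- The resultant of `x³ + ax² + bx + 1` and its derivative (minus the discriminant). -/
def R (p : ℝ × ℝ) : ℝ :=
  -p.1 ^ 2 * p.2 ^ 2 + 4 * p.1 ^ 3 + 4 * p.2 ^ 3 - 18 * p.1 * p.2 + 27

/-- The resolvent curve `R = 0`. -/
def resolventCurve : Set (ℝ × ℝ) := {p | R p = 0}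

theorem neg_one_mem_resolventCurve : ((-1, -1) : ℝ × ℝ) ∈ resolventCurve := by
  simp only [resolventCurve, R, Set.mem_ofPred_eq]; norm_num

/-- The connected component of the resolvent curve that contains `(-1,-1)`
(the other component, `L₁`, has its cusp at `(3,3)`). -/
def L₂ : Set (ℝ × ℝ) := connectedComponentIn resolventCurve (-1, -1)

theorem neg_two_notMem_resolventCurve : ((-2, -2) : ℝ × ℝ) ∈ resolventCurveᶜ := by
  simp only [resolventCurve, R, Set.mem_compl_iff, Set.mem_ofPred_eq]; norm_num

/-- The connected component of the complement of the resolvent curve that lies below the curve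
`L₂`; it is the one that contains `(-2,-2)`, and `x³ + ax² + bx + 1` has two different positive
roots for `(a,b)` in it. -/
def C₁ : Set (ℝ × ℝ) := connectedComponentIn resolventCurveᶜ (-2, -2)

/-- The diagonal `a = b`. -/
def R₁ : Set (ℝ × ℝ) := {p | p.1 = p.2}

/-- The constant `172 + 12√177`. -/
def A : ℝ := 172 + 12 * √177

/-- The saddle fixed point of `G`, approximately `(-4.20557, 3.95774)`. -/
def P₂ : ℝ × ℝ :=
  ((-43 + 3 * √177) / 384 * A ^ ((2 : ℝ) / 3) - 1 / 6 * A ^ ((1 : ℝ) / 3) - 8 / 3,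
    (13 - √177) / 48 * A ^ ((2 : ℝ) / 3) + (7 + √177) / 48 * A ^ ((1 : ℝ) / 3) + 4 / 3)

end

end Landen

/-!
A point `(a, b)` is read as the cubic `x³ + a x² + b x + 1`. On the level of roots the map `G` is
`s ↦ c s / (s - 1)²` with `c = (a + b + 2)^{2/3}`, and `-R` is the discriminant. The theorem rests
on the following facts.

* `R (G p) (a + b + 2)⁴ = R p (a - b)²` (`R_G_mul`). Hence a point that `G` sends to the curve
  `R = 0` lies on the curve or on the diagonal. At `P₂` the factor `(a - b)² / (a + b + 2)⁴`
  exceeds `2`, so `|R|` at least doubles along every orbit that stays near `P₂`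
  (`exists_nhds_expansion`); since `R P₂ = 0`, an orbit that converges to `P₂` ends up in `R = 0`.
  No linearization at the saddle is needed.
* The curve `R = 0` consists of the cubics with a double root `r ≠ 0`, and `L₂` is the part with
  `r > 0` (`L₂_eq_image`). On it `G` acts through the one-dimensional map `rootMap`, which takes
  values in `[2, ∞)` and contracts that half line in the logarithmic metric
  (`abs_log_rootMap_sub_le`); so all of `L₂` except `(-1, -1)` is attracted by `P₂`.
* A diagonal point `(a, a)` is sent to the double root `-2 / ∛(2a + 2)` (`G_diagonal`), which is
  positive precisely for `a < -1`, that is, on `R₁ ∩ C₁` (`mem_R₁_inter_C₁`).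

Both `L₂` and `C₁` are identified by one separation: the set `R ≤ 0` is disjoint from the boundary
of the quadrant `a > 1, b > 1` (`mem_lower_or_upper_of_R_nonpos`).
-/

namespace Landen

noncomputable section

/-! ### The real cube root -/

theorem cbrt_ne_zero {x : ℝ} (hx : x ≠ 0) : cbrt x ≠ 0 := by
  intro h
  have := cbrt_pow_three x
  rw [h] at this
  exact hx (by rw [← this]; norm_num)

theorem cbrt_neg_of_neg {x : ℝ} (hx : x < 0) : cbrt x < 0 := by
  have h : cbrt x ^ 3 < 0 := by rwa [cbrt_pow_three]
  exact (Odd.pow_neg_iff (by decide)).1 h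

theorem cbrt_pos_of_pos {x : ℝ} (hx : 0 < x) : 0 < cbrt x := by
  have h : 0 < cbrt x ^ 3 := by rwa [cbrt_pow_three]
  exact (Odd.pow_pos_iff (by decide)).1 h

/-! ### The discriminant under the map -/

/-- The discriminant is multiplied by `(a - b)² / (a + b + 2)⁴` under `G`. -/
theorem R_G_mul {p : ℝ × ℝ} (hp : p ∈ domainG) :
    R (G p) * (p.1 + p.2 + 2) ^ 4 = R p * (p.1 - p.2) ^ 2 := by
  obtain ⟨a, b⟩ := p
  have hT : a + b + 2 ≠ 0 := hp
  have hk := cbrt_ne_zero hT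
  have hk3 := cbrt_pow_three (a + b + 2)
  simp only [R, G]
  generalize cbrt (a + b + 2) = k at hk hk3
  have hb : b = k ^ 3 - a - 2 := by linarith
  subst hb
  field_simp
  ring

theorem continuous_R : Continuous R := by
  unfold R
  fun_prop

/-! ### Cubics with a double root -/

/-- The point `(a, b)` for which `x³ + a x² + b x + 1` has the double root `r ≠ 0`; the third root
is `-1/r²`. -/
def doubleRootPoint (r : ℝ) : ℝ × ℝ := (-2 * r + 1 / r ^ 2, r ^ 2 - 2 / r)

theorem R_doubleRootPoint {r : ℝ} (hr : r ≠ 0) : R (doubleRootPoint r) = 0 := by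
  simp only [R, doubleRootPoint]
  field_simp
  ring

/-- The double root of a cubic with vanishing discriminant is `(9 - ab) / (2(a² - 3b))`, unless the
root is triple, which happens only at `(3, 3)`. -/
theorem exists_doubleRootPoint_of_R_eq_zero {p : ℝ × ℝ} (hp : R p = 0) :
    ∃ r, r ≠ 0 ∧ p = doubleRootPoint r := by
  obtain ⟨a, b⟩ := p
  simp only [R] at hp
  have cube_eq : ∀ x : ℝ, x ^ 3 = 27 → x = 3 := fun x hx =>
    (Odd.strictMono_pow (n := 3) (by decide)).injective (by simpa using hx.trans (by norm_num))
  by_cases hD : a ^ 2 - 3 * b = 0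
  · have hb : b = a ^ 2 / 3 := by linarith
    subst hb
    have ha : a = 3 := by
      refine cube_eq a ?_
      have : (a ^ 3 - 27) ^ 2 = 0 := by linear_combination 27 * hp
      linarith [pow_eq_zero_iff (two_ne_zero) |>.1 this]
    subst ha
    exact ⟨-1, by norm_num, by norm_num [doubleRootPoint]⟩
  · have hE : 9 - a * b ≠ 0 := by
      intro hE
      have h9 : a * b = 9 := by linarith
      have ha : a = 3 := by
        refine cube_eq a ?_
        have h2 : a ^ 3 * b ^ 3 = 729 := by rw [← mul_pow, h9]; norm_num
        have h3 : a ^ 3 + b ^ 3 = 54 := by linear_combination hp / 4 + (a * b + 27) / 4 * h9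
        have : (a ^ 3 - 27) ^ 2 = 0 := by linear_combination a ^ 3 * h3 - h2
        linarith [pow_eq_zero_iff (two_ne_zero) |>.1 this]
      subst ha
      apply hD
      linarith
    refine ⟨(9 - a * b) / (2 * (a ^ 2 - 3 * b)), by positivity, ?_⟩
    have h₁ : 2 * (a ^ 2 - 3 * b) * (9 - a * b) ^ 2 * a + 2 * (9 - a * b) ^ 3
        - 8 * (a ^ 2 - 3 * b) ^ 3 = 0 := by
      linear_combination (54 - 2 * a ^ 3) * hp
    have h₂ : 4 * (a ^ 2 - 3 * b) ^ 2 * (9 - a * b) * b - (9 - a * b) ^ 3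
        + 16 * (a ^ 2 - 3 * b) ^ 3 = 0 := by
      linear_combination (4 * a ^ 3 - 9 * a * b - 27) * hp
    generalize a ^ 2 - 3 * b = D at *
    generalize 9 - a * b = E at *
    simp only [doubleRootPoint, Prod.mk.injEq]
    constructor
    · field_simp
      linear_combination h₁ / 2
    · field_simp
      linear_combination h₂

theorem sum_doubleRootPoint {r : ℝ} (hr : r ≠ 0) :
    (doubleRootPoint r).1 + (doubleRootPoint r).2 + 2 = (r - 1) ^ 2 * (r ^ 2 + 1) / r ^ 2 := by
  simp only [doubleRootPoint]
  field_simp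
  ring

theorem doubleRootPoint_mem_domainG {r : ℝ} (hr : r ≠ 0) (hr1 : r ≠ 1) :
    doubleRootPoint r ∈ domainG := by
  have : (doubleRootPoint r).1 + (doubleRootPoint r).2 + 2 ≠ 0 := by
    rw [sum_doubleRootPoint hr]
    have := sub_ne_zero.2 hr1
    positivity
  exact this

/-- The action of `G` on the double root. -/
def rootMap (r : ℝ) : ℝ := cbrt ((r - 1) ^ 2 * (r ^ 2 + 1) / r ^ 2) ^ 2 * r / (r - 1) ^ 2

theorem G_doubleRootPoint {r : ℝ} (hr : r ≠ 0) (hr1 : r ≠ 1) :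
    G (doubleRootPoint r) = doubleRootPoint (rootMap r) := by
  have h1 : r - 1 ≠ 0 := sub_ne_zero.2 hr1
  have hT : (r - 1) ^ 2 * (r ^ 2 + 1) / r ^ 2 ≠ 0 := by positivity
  have hk := cbrt_ne_zero hT
  have hk3 := cbrt_pow_three ((r - 1) ^ 2 * (r ^ 2 + 1) / r ^ 2)
  simp only [G, sum_doubleRootPoint hr, rootMap]
  generalize cbrt ((r - 1) ^ 2 * (r ^ 2 + 1) / r ^ 2) = k at hk hk3
  have hk6 : k ^ 6 * r ^ 4 = ((r - 1) ^ 2 * (r ^ 2 + 1)) ^ 2 := by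
    rw [show k ^ 6 = (k ^ 3) ^ 2 by ring, hk3]
    field_simp
  simp only [doubleRootPoint, Prod.mk.injEq]
  constructor
  · field_simp
    linear_combination 2 * hk6
  · field_simp
    linear_combination -hk6

theorem rootMap_pow_three {r : ℝ} (hr : r ≠ 0) (hr1 : r ≠ 1) :
    rootMap r ^ 3 = (r ^ 2 + 1) ^ 2 / (r * (r - 1) ^ 2) := by
  have h1 : r - 1 ≠ 0 := sub_ne_zero.2 hr1
  have : rootMap r ^ 3 = (cbrt ((r - 1) ^ 2 * (r ^ 2 + 1) / r ^ 2) ^ 3) ^ 2 * r ^ 3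
      / (r - 1) ^ 6 := by
    rw [rootMap, div_pow, mul_pow, ← pow_mul, ← pow_mul, ← pow_mul]
  rw [this, cbrt_pow_three]
  field_simp

theorem rootMap_neg {r : ℝ} (hr : r < 0) : rootMap r < 0 := by
  have h1 : r - 1 ≠ 0 := by linarith
  have h0 : r ≠ 0 := hr.ne
  have h : 0 < cbrt ((r - 1) ^ 2 * (r ^ 2 + 1) / r ^ 2) :=
    cbrt_pos_of_pos (by positivity)
  exact div_neg_of_neg_of_pos (mul_neg_of_pos_of_neg (by positivity) hr) (by positivity)

/-- In terms of `u = r + 1/r` the cube of `rootMap r` is `u² / (u - 2)`, whose minimum is `8`. -/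
theorem two_le_rootMap {r : ℝ} (hr : 0 < r) (hr1 : r ≠ 1) : 2 ≤ rootMap r := by
  have h1 : r - 1 ≠ 0 := sub_ne_zero.2 hr1
  have h : (2 : ℝ) ^ 3 ≤ rootMap r ^ 3 := by
    rw [rootMap_pow_three hr.ne' hr1, le_div_iff₀ (by positivity)]
    linarith [sq_nonneg (r ^ 2 - 4 * r + 1),
      show (r ^ 2 + 1) ^ 2 - 2 ^ 3 * (r * (r - 1) ^ 2) = (r ^ 2 - 4 * r + 1) ^ 2 by ring]
  exact (Odd.strictMono_pow (by decide)).le_iff_le.1 h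

/-! ### Contraction of the map on double roots -/

/-- With `f = rootMap`, the function `f(r)³ r²` is increasing and `f(r)³ / r²` is decreasing on
`[2, ∞)`; the logarithms of the two monotonicity inequalities give the two bounds. -/
theorem abs_log_rootMap_sub_le_of_le {x y : ℝ} (hx : 2 ≤ x) (hxy : x ≤ y) :
    |Real.log (rootMap y) - Real.log (rootMap x)| ≤ 2 / 3 * |Real.log y - Real.log x| := by
  have hx0 : 0 < x := by linarith
  have hy0 : 0 < y := by linarith
  have hx1 : 0 < x - 1 := by linarith
  have hy1 : 0 < y - 1 := by linarith
  have hfx : 0 < rootMap x := by linarith [two_le_rootMap hx0 (by linarith)]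
  have hfy : 0 < rootMap y := by linarith [two_le_rootMap hy0 (by linarith)]
  have hx3 := rootMap_pow_three hx0.ne' (by linarith)
  have hy3 := rootMap_pow_three hy0.ne' (by linarith)
  have up : rootMap x ^ 3 * x ^ 2 ≤ rootMap y ^ 3 * y ^ 2 := by
    rw [hx3, hy3, div_mul_eq_mul_div, div_mul_eq_mul_div,
      div_le_div_iff₀ (by positivity) (by positivity)]
    have key : x * (x ^ 2 + 1) ^ 2 * (y - 1) ^ 2 ≤ y * (y ^ 2 + 1) ^ 2 * (x - 1) ^ 2 := by
      obtain ⟨s, rfl⟩ : ∃ s, x = 2 + s := ⟨x - 2, by ring⟩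
      obtain ⟨t, rfl⟩ : ∃ t, y = 2 + s + t := ⟨y - (2 + s), by ring⟩
      have hs : 0 ≤ s := by linarith
      have ht : 0 ≤ t := by linarith
      rw [← sub_nonneg]
      ring_nf
      positivity
    calc _ = (x * (x ^ 2 + 1) ^ 2 * (y - 1) ^ 2) * (x * y) := by ring
      _ ≤ (y * (y ^ 2 + 1) ^ 2 * (x - 1) ^ 2) * (x * y) := by gcongr
      _ = _ := by ring
  have down : rootMap y ^ 3 * x ^ 2 ≤ rootMap x ^ 3 * y ^ 2 := by
    rw [hx3, hy3, div_mul_eq_mul_div, div_mul_eq_mul_div,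
      div_le_div_iff₀ (by positivity) (by positivity)]
    have h1 : (y ^ 2 + 1) * x ^ 2 ≤ (x ^ 2 + 1) * y ^ 2 := by nlinarith
    have h2 : y * (x - 1) ^ 2 ≤ x * (y - 1) ^ 2 := by
      nlinarith [mul_nonneg (sub_nonneg.2 hxy) (show 0 ≤ x * y - 1 by nlinarith)]
    refine le_of_mul_le_mul_right ?_ (mul_pos hx0 hy0)
    calc _ = ((y ^ 2 + 1) * x ^ 2) ^ 2 * (y * (x - 1) ^ 2) := by ring
      _ ≤ ((x ^ 2 + 1) * y ^ 2) ^ 2 * (x * (y - 1) ^ 2) := by gcongr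
      _ = _ := by ring
  have hup := Real.log_le_log (by positivity) up
  have hdown := Real.log_le_log (by positivity) down
  rw [Real.log_mul (by positivity) (by positivity), Real.log_mul (by positivity) (by positivity),
    Real.log_pow, Real.log_pow, Real.log_pow, Real.log_pow] at hup hdown
  push_cast at hup hdown
  rw [abs_of_nonneg (sub_nonneg.2 (Real.log_le_log hx0 hxy)), abs_le]
  constructor <;> linarith

/-- `rootMap` contracts `[2, ∞)` in the logarithmic metric. -/
theorem abs_log_rootMap_sub_le {x y : ℝ} (hx : 2 ≤ x) (hy : 2 ≤ y) :
    |Real.log (rootMap y) - Real.log (rootMap x)| ≤ 2 / 3 * |Real.log y - Real.log x| := by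
  rcases le_total x y with h | h
  · exact abs_log_rootMap_sub_le_of_le hx h
  · rw [abs_sub_comm, abs_sub_comm (Real.log y)]
    exact abs_log_rootMap_sub_le_of_le hy h

theorem two_le_iterate_rootMap {r : ℝ} (hr : 2 ≤ r) (n : ℕ) : 2 ≤ rootMap^[n] r := by
  induction n with
  | zero => exact hr
  | succ n ih =>
    rw [Function.iterate_succ_apply']
    exact two_le_rootMap (by linarith) (by linarith)

theorem tendsto_iterate_rootMap {r s : ℝ} (hr : 2 ≤ r) (hs : 2 ≤ s) (hfix : rootMap s = s) :
    Tendsto (fun n : ℕ => rootMap^[n] r) atTop (𝓝 s) := by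
  have bound : ∀ n : ℕ, |Real.log (rootMap^[n] r) - Real.log s| ≤
      (2 / 3) ^ n * |Real.log r - Real.log s| := by
    intro n
    induction n with
    | zero => simp
    | succ n ih =>
      have h := abs_log_rootMap_sub_le hs (two_le_iterate_rootMap hr n)
      rw [hfix] at h
      rw [Function.iterate_succ_apply', pow_succ]
      linarith
  have hlim : Tendsto (fun n : ℕ => (2 / 3 : ℝ) ^ n * |Real.log r - Real.log s|) atTop (𝓝 0) := by
    simpa using (tendsto_pow_atTop_nhds_zero_of_lt_one (r := (2 / 3 : ℝ)) (by norm_num)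
      (by norm_num)).mul_const |Real.log r - Real.log s|
  have hlog : Tendsto (fun n : ℕ => Real.log (rootMap^[n] r)) atTop (𝓝 (Real.log s)) := by
    rw [tendsto_iff_dist_tendsto_zero]
    exact squeeze_zero (fun _ => dist_nonneg) bound hlim
  have hexp := (Real.continuous_exp.tendsto _).comp hlog
  rw [Real.exp_log (by linarith)] at hexp
  refine hexp.congr fun n => ?_
  exact Real.exp_log (by linarith [two_le_iterate_rootMap hr n])

/-! ### The saddle point -/

/-- Cardano's formula: `P₂` is the double-root point of the real root of `r³ - 2r² - 1`. -/
theorem exists_P₂_eq :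
    ∃ r : ℝ, 2 < r ∧ r < 9 / 4 ∧ r ^ 3 - 2 * r ^ 2 = 1 ∧ P₂ = doubleRootPoint r := by
  have hA : 0 < A := by unfold A; positivity
  have hs : √(177 : ℝ) ^ 2 = 177 := Real.sq_sqrt (by norm_num)
  have hB2 : A ^ ((2 : ℝ) / 3) = (A ^ ((1 : ℝ) / 3)) ^ 2 := by
    rw [← Real.rpow_natCast, ← Real.rpow_mul hA.le]
    norm_num
  have hB3 : (A ^ ((1 : ℝ) / 3)) ^ 3 = 172 + 12 * √177 := by
    rw [← Real.rpow_natCast, ← Real.rpow_mul hA.le]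
    norm_num [A]
  unfold P₂
  rw [hB2]
  generalize A ^ ((1 : ℝ) / 3) = B at hB3
  generalize √(177 : ℝ) = q at hs hB3
  have hB0 : B ≠ 0 := by
    rintro rfl
    have : q = -172 / 12 := by linarith
    rw [this] at hs
    norm_num at hs
  -- `16 / B` is the other cube root in Cardano's formula.
  obtain ⟨C, hC⟩ : ∃ C, C = (43 - 3 * q) * B ^ 2 / 64 := ⟨_, rfl⟩
  have hBC : B * C = 16 := by
    rw [hC]
    linear_combination (43 - 3 * q) / 64 * hB3 - 36 / 64 * hs
  have hC3 : C ^ 3 = 172 - 12 * q := by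
    refine mul_left_cancel₀ (pow_ne_zero 3 hB0) ?_
    rw [← mul_pow, hBC, hB3]
    linear_combination 144 * hs
  have hC2 : C ^ 2 = (43 - 3 * q) / 4 * B := by
    linear_combination C * hC + (43 - 3 * q) / 64 * B * hBC
  obtain ⟨r, hr⟩ : ∃ r, r = 2 / 3 + (B + C) / 6 := ⟨_, rfl⟩
  have hr3 : r ^ 3 - 2 * r ^ 2 = 1 := by
    rw [hr]
    linear_combination (hB3 + hC3) / 216 + (B + C) / 72 * hBC
  have hr2 : 2 < r := by nlinarith [sq_nonneg r]
  have hr0 : r ≠ 0 := by linarith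
  refine ⟨r, hr2, by nlinarith, hr3, ?_⟩
  have h1 : 1 / r ^ 2 = r - 2 := by
    field_simp
    linarith
  have h2 : 2 / r = 2 * r * (r - 2) := by
    field_simp
    linarith
  simp only [doubleRootPoint, h1, h2, Prod.mk.injEq]
  constructor
  · rw [hr, hC]
    ring
  · rw [hr]
    linear_combination (-4 / 9) * hC + hC2 / 36 + hBC / 18

theorem rootMap_eq_self {r : ℝ} (hr : 2 < r) (h : r ^ 3 - 2 * r ^ 2 = 1) : rootMap r = r := by
  refine (Odd.strictMono_pow (n := 3) (by decide)).injective ?_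
  have h0 : r ≠ 0 := by linarith
  have h1 : r - 1 ≠ 0 := by linarith
  show rootMap r ^ 3 = r ^ 3
  rw [rootMap_pow_three h0 (by linarith), show r ^ 2 + 1 = r ^ 2 * (r - 1) by linear_combination -h]
  field_simp

/-- Away from `(-1, -1)`, where the double root is `1`, every cubic with a positive double root is
attracted by `P₂`. -/
theorem doubleRootPoint_mem_stableSet {r : ℝ} (hr : 0 < r) (hr1 : r ≠ 1) :
    doubleRootPoint r ∈ stableSet P₂ := by
  obtain ⟨s, hs2, -, hs, hP⟩ := exists_P₂_eq
  have hpos : ∀ n : ℕ, 0 < rootMap^[n] r ∧ rootMap^[n] r ≠ 1 := by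
    intro n
    induction n with
    | zero => exact ⟨hr, hr1⟩
    | succ n ih =>
      rw [Function.iterate_succ_apply']
      have := two_le_rootMap ih.1 ih.2
      exact ⟨by linarith, by linarith⟩
  have hit : ∀ n : ℕ, G^[n] (doubleRootPoint r) = doubleRootPoint (rootMap^[n] r) := by
    intro n
    induction n with
    | zero => rfl
    | succ n ih =>
      rw [Function.iterate_succ_apply', Function.iterate_succ_apply', ih,
        G_doubleRootPoint (hpos n).1.ne' (hpos n).2]
  refine ⟨fun n k _ => ?_, ?_⟩
  · rw [hit]
    exact doubleRootPoint_mem_domainG (hpos k).1.ne' (hpos k).2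
  · simp only [hit]
    have hlim : Tendsto (fun n : ℕ => rootMap^[n] r) atTop (𝓝 s) := by
      rw [← tendsto_add_atTop_iff_nat 1]
      exact tendsto_iterate_rootMap (two_le_rootMap hr hr1) hs2.le (rootMap_eq_self hs2 hs)
    have hs0 : s ≠ 0 := by linarith
    have hcont : ContinuousAt doubleRootPoint s := by
      unfold doubleRootPoint
      fun_prop (disch := positivity)
    rw [hP]
    exact hcont.tendsto.comp hlim

/-! ### The components of the resolvent curve and of its complement -/

/-- The complement of the closed quadrant `a ≥ 1, b ≥ 1`. -/
def lowerPart : Set (ℝ × ℝ) := {p | p.1 < 1 ∨ p.2 < 1}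

/-- The open quadrant `a > 1, b > 1`. -/
def upperPart : Set (ℝ × ℝ) := {p | 1 < p.1 ∧ 1 < p.2}

theorem isOpen_lowerPart : IsOpen lowerPart :=
  (isOpen_lt continuous_fst continuous_const).union (isOpen_lt continuous_snd continuous_const)

theorem isOpen_upperPart : IsOpen upperPart :=
  (isOpen_lt continuous_const continuous_fst).inter (isOpen_lt continuous_const continuous_snd)

theorem disjoint_lowerPart_upperPart : Disjoint lowerPart upperPart := by
  rw [Set.disjoint_left]
  rintro p (h | h) ⟨h1, h2⟩ <;> linarith

theorem mem_lower_or_upper_of_R_nonpos {p : ℝ × ℝ} (hp : R p ≤ 0) :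
    p ∈ lowerPart ∪ upperPart := by
  obtain ⟨a, b⟩ := p
  -- The value of `R` on the boundary of the quadrant, up to exchanging the coordinates.
  have key : ∀ t : ℝ, 1 ≤ t → 0 < 4 * t ^ 3 - t ^ 2 - 18 * t + 31 := by
    intro t ht
    nlinarith [mul_nonneg (sub_nonneg.2 ht) (sq_nonneg (t - 13 / 10)), sq_nonneg (t - 13 / 10)]
  simp only [R] at hp
  by_contra h
  simp only [lowerPart, upperPart, Set.mem_union, Set.mem_ofPred_eq, not_or, not_and, not_lt] at h
  obtain ⟨⟨ha, hb⟩, h⟩ := h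
  rcases ha.eq_or_lt with rfl | ha
  · linarith [key b hb]
  · obtain rfl : b = 1 := le_antisymm (h ha) hb
    linarith [key a ha.le]

theorem doubleRootPoint_mem_lowerPart_iff {r : ℝ} (hr : r ≠ 0) :
    doubleRootPoint r ∈ lowerPart ↔ 0 < r := by
  simp only [lowerPart, doubleRootPoint, Set.mem_ofPred_eq]
  constructor
  · intro h
    by_contra hneg
    have hr0 : r < 0 := lt_of_le_of_ne (not_lt.1 hneg) hr
    have h1 : 0 < 1 / r ^ 2 := by positivity
    have e1 : r ^ 2 * (1 / r ^ 2) = 1 := by field_simp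
    have h2 : 2 / r < 0 := div_neg_of_pos_of_neg two_pos hr0
    have e2 : r * (2 / r) = 2 := by field_simp
    rcases h with h | h <;> rcases le_total r (-1) with h' | h' <;> nlinarith
  · intro h
    rcases le_total 1 r with h' | h'
    · left
      have : 1 / r ^ 2 ≤ 1 := by
        rw [div_le_one (by positivity)]
        nlinarith
      linarith
    · right
      have : 2 ≤ 2 / r := by
        rw [le_div_iff₀ h]
        linarith
      nlinarith

theorem L₂_eq_inter : L₂ = resolventCurve ∩ lowerPart := by
  have hbase : ((-1, -1) : ℝ × ℝ) = doubleRootPoint 1 := by norm_num [doubleRootPoint]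
  apply Set.Subset.antisymm
  · refine Set.subset_inter (connectedComponentIn_subset _ _) ?_
    refine isPreconnected_connectedComponentIn.subset_left_of_subset_union isOpen_lowerPart
      isOpen_upperPart disjoint_lowerPart_upperPart ?_ ?_
    · intro p hp
      have : R p = 0 := connectedComponentIn_subset resolventCurve _ hp
      exact mem_lower_or_upper_of_R_nonpos this.le
    · exact ⟨(-1, -1), mem_connectedComponentIn neg_one_mem_resolventCurve, Or.inl (by norm_num)⟩
  · have hconn : IsPreconnected (doubleRootPoint '' Set.Ioi 0) := by
      refine isPreconnected_Ioi.image _ ?_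
      unfold doubleRootPoint
      have : ∀ x ∈ Set.Ioi (0 : ℝ), x ≠ 0 := fun x hx => ne_of_gt hx
      have h2 : ∀ x ∈ Set.Ioi (0 : ℝ), x ^ 2 ≠ 0 := fun x hx => pow_ne_zero 2 (this x hx)
      fun_prop (disch := assumption)
    have hsub : doubleRootPoint '' Set.Ioi 0 ⊆ L₂ := by
      refine hconn.subset_connectedComponentIn ⟨1, Set.mem_Ioi.2 one_pos, hbase.symm⟩ ?_
      rintro _ ⟨r, hr, rfl⟩
      exact R_doubleRootPoint (ne_of_gt hr)
    rintro p ⟨hp, hpl⟩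
    obtain ⟨r, hr, rfl⟩ := exists_doubleRootPoint_of_R_eq_zero hp
    exact hsub ⟨r, (doubleRootPoint_mem_lowerPart_iff hr).1 hpl, rfl⟩

/-- `L₂` consists of the cubics with a positive double root. -/
theorem L₂_eq_image : L₂ = doubleRootPoint '' Set.Ioi 0 := by
  rw [L₂_eq_inter]
  ext p
  constructor
  · rintro ⟨hp, hpl⟩
    obtain ⟨r, hr, rfl⟩ := exists_doubleRootPoint_of_R_eq_zero hp
    exact ⟨r, (doubleRootPoint_mem_lowerPart_iff hr).1 hpl, rfl⟩
  · rintro ⟨r, hr, rfl⟩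
    exact ⟨R_doubleRootPoint (ne_of_gt hr), (doubleRootPoint_mem_lowerPart_iff (ne_of_gt hr)).2 hr⟩

theorem R_diagonal (a : ℝ) : R (a, a) = -((a - 3) ^ 3 * (a + 1)) := by
  simp only [R]
  ring

theorem C₁_subset : C₁ ⊆ {p | R p < 0} ∩ lowerPart := by
  have hbase := mem_connectedComponentIn neg_two_notMem_resolventCurve
  have hneg : C₁ ⊆ {p | R p < 0} := by
    refine isPreconnected_connectedComponentIn.subset_left_of_subset_union
      (v := {p | 0 < R p}) (isOpen_lt continuous_R continuous_const)
      (isOpen_lt continuous_const continuous_R) ?_ ?_ ⟨_, hbase, ?_⟩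
    · rw [Set.disjoint_left]
      intro p (h1 : R p < 0) (h2 : 0 < R p)
      linarith
    · intro p hp
      exact lt_or_gt_of_ne (connectedComponentIn_subset _ _ hp)
    · show R (-2, -2) < 0
      norm_num [R]
  refine Set.subset_inter hneg ?_
  refine isPreconnected_connectedComponentIn.subset_left_of_subset_union isOpen_lowerPart
    isOpen_upperPart disjoint_lowerPart_upperPart ?_ ⟨_, hbase, Or.inl (by norm_num)⟩
  exact fun p hp => mem_lower_or_upper_of_R_nonpos (le_of_lt (hneg hp))

theorem mem_R₁_inter_C₁ {p : ℝ × ℝ} : p ∈ R₁ ∩ C₁ ↔ p.1 = p.2 ∧ p.1 < -1 := by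
  obtain ⟨a, b⟩ := p
  constructor
  · rintro ⟨hd, hC⟩
    obtain rfl : a = b := hd
    obtain ⟨hR, hl⟩ := C₁_subset hC
    have ha : a < 1 := hl.elim id id
    have hR' : R (a, a) < 0 := hR
    rw [R_diagonal] at hR'
    refine ⟨rfl, ?_⟩
    by_contra h
    have h3 : (a - 3) ^ 3 < 0 := Odd.pow_neg (by decide) (by linarith)
    simp only [not_lt] at h
    nlinarith
  · rintro ⟨hd, ha⟩
    obtain rfl : a = b := hd
    refine ⟨rfl, ?_⟩
    have hconn : IsPreconnected ((fun t : ℝ => (t, t)) '' Set.Iio (-1)) :=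
      isPreconnected_Iio.image _ (by fun_prop)
    refine hconn.subset_connectedComponentIn ⟨-2, by norm_num, rfl⟩ ?_ ⟨a, ha, rfl⟩
    rintro _ ⟨t, ht, rfl⟩
    have ht : t < -1 := ht
    show R (t, t) ≠ 0
    rw [R_diagonal]
    exact neg_ne_zero.2 (mul_ne_zero (pow_ne_zero 3 (by linarith)) (by linarith))

/-- The roots of the cubic of `(a, a)` are `-1`, `t` and `1/t`; `G` merges the last two. -/
theorem G_diagonal {a : ℝ} (ha : a ≠ -1) :
    G (a, a) = doubleRootPoint (-2 / cbrt (a + a + 2)) := by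
  have hk : cbrt (a + a + 2) ≠ 0 := cbrt_ne_zero fun h => ha (by linarith)
  have hk3 := cbrt_pow_three (a + a + 2)
  simp only [G, doubleRootPoint]
  generalize cbrt (a + a + 2) = k at hk hk3
  obtain rfl : a = (k ^ 3 - 2) / 2 := by linarith
  simp only [Prod.mk.injEq]
  constructor <;> field_simp <;> ring

/-- A point outside `L₂` that `G` sends into `L₂` is a diagonal point of `C₁`. -/
theorem mem_R₁_inter_C₁_of_G_mem_L₂ {p : ℝ × ℝ} (hp : p ∈ domainG) (hpL : p ∉ L₂)
    (hG : G p ∈ L₂) : p ∈ R₁ ∩ C₁ := by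
  rw [L₂_eq_inter] at hG
  have hR0 : R (G p) = 0 := hG.1
  have hmul := R_G_mul hp
  rw [hR0, zero_mul, eq_comm, mul_eq_zero] at hmul
  rcases hmul with hR | hd
  · obtain ⟨r, hr, rfl⟩ := exists_doubleRootPoint_of_R_eq_zero hR
    exfalso
    have hr0 : r < 0 := by
      refine lt_of_le_of_ne (not_lt.1 fun h => hpL ?_) hr
      rw [L₂_eq_image]
      exact ⟨r, h, rfl⟩
    have hneg := rootMap_neg hr0
    have := hG.2
    rw [G_doubleRootPoint hr (by linarith), doubleRootPoint_mem_lowerPart_iff hneg.ne] at this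
    linarith
  · obtain ⟨a, b⟩ := p
    obtain rfl : a = b := sub_eq_zero.1 (pow_eq_zero_iff two_ne_zero |>.1 hd)
    have hT : a + a + 2 ≠ 0 := hp
    have hk := cbrt_ne_zero hT
    have := hG.2
    rw [G_diagonal (fun h => hT (by linarith)),
      doubleRootPoint_mem_lowerPart_iff (div_ne_zero (by norm_num) hk)] at this
    refine mem_R₁_inter_C₁.2 ⟨rfl, ?_⟩
    show a < -1
    by_contra h
    have hpos : 0 < cbrt (a + a + 2) :=
      cbrt_pos_of_pos (lt_of_le_of_ne (by linarith) hT.symm)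
    linarith [div_neg_of_neg_of_pos (show (-2 : ℝ) < 0 by norm_num) hpos]

/-! ### Repulsion from the resolvent curve near the saddle -/

theorem P₂_mem_L₂ : P₂ ∈ L₂ := by
  obtain ⟨r, hr, -, -, hP⟩ := exists_P₂_eq
  rw [L₂_eq_image, hP]
  exact ⟨r, show 0 < r by linarith, rfl⟩

theorem R_P₂ : R P₂ = 0 := by
  have := P₂_mem_L₂
  rw [L₂_eq_inter] at this
  exact this.1

/-- Near the saddle, `G` at least doubles `|R|`. -/
theorem exists_nhds_expansion :
    ∃ U ∈ 𝓝 P₂, ∀ p ∈ U, p ∈ lowerPart ∧ (p ∈ domainG → 2 * |R p| ≤ |R (G p)|) := by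
  have hl : ∀ᶠ p in 𝓝 P₂, p ∈ lowerPart :=
    isOpen_lowerPart.mem_nhds (by have := P₂_mem_L₂; rw [L₂_eq_inter] at this; exact this.2)
  have hexp : ∀ᶠ p : ℝ × ℝ in 𝓝 P₂, 2 * (p.1 + p.2 + 2) ^ 4 < (p.1 - p.2) ^ 2 := by
    refine (isOpen_lt (by fun_prop) (by fun_prop)).mem_nhds ?_
    obtain ⟨r, hr2, hr9, hr, hP⟩ := exists_P₂_eq
    have h0 : r ≠ 0 := by linarith
    have h1 : 1 / r ^ 2 = r - 2 := by
      field_simp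
      linarith
    have h2 : 2 / r = 2 * r * (r - 2) := by
      field_simp
      linarith
    show 2 * (P₂.1 + P₂.2 + 2) ^ 4 < (P₂.1 - P₂.2) ^ 2
    rw [hP]
    simp only [doubleRootPoint, h1, h2]
    have e1 : -2 * r + (r - 2) + (r ^ 2 - 2 * r * (r - 2)) + 2 = r * (3 - r) := by ring
    have e2 : (-2 * r + (r - 2) - (r ^ 2 - 2 * r * (r - 2))) ^ 2 = (2 + 5 * r - r ^ 2) ^ 2 := by
      ring
    rw [e1, e2]
    have b1 : (r * (3 - r)) ^ 4 ≤ 2 ^ 4 :=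
      pow_le_pow_left₀ (by nlinarith) (by nlinarith) 4
    have b2 : (8 : ℝ) ^ 2 ≤ (2 + 5 * r - r ^ 2) ^ 2 :=
      pow_le_pow_left₀ (by norm_num) (by nlinarith) 2
    linarith
  refine ⟨_, hl.and hexp, ?_⟩
  rintro p ⟨hpl, hpe⟩
  refine ⟨hpl, fun hp => ?_⟩
  have hpe : 2 * (p.1 + p.2 + 2) ^ 4 < (p.1 - p.2) ^ 2 := hpe
  have hT : p.1 + p.2 + 2 ≠ 0 := hp
  have hT4 : 0 < (p.1 + p.2 + 2) ^ 4 := by positivity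
  have h := congrArg abs (R_G_mul hp)
  rw [abs_mul, abs_mul, abs_of_pos hT4, abs_of_nonneg (sq_nonneg (p.1 - p.2))] at h
  refine le_of_mul_le_mul_right ?_ hT4
  rw [h]
  nlinarith [abs_nonneg (R p)]

/-- An orbit that converges to the saddle inside a neighbourhood where `|R|` doubles lies on the
resolvent curve, since `R` tends to `R P₂ = 0` along it. -/
theorem R_eq_zero_of_orbit_mem {U : Set (ℝ × ℝ)}
    (hU : ∀ p ∈ U, p ∈ domainG → 2 * |R p| ≤ |R (G p)|) {p : ℝ × ℝ} (hp : p ∈ stableSet P₂)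
    (hpU : ∀ n : ℕ, G^[n] p ∈ U) : R p = 0 := by
  have hgrow : ∀ n : ℕ, |R p| ≤ |R (G^[n] p)| := by
    intro n
    induction n with
    | zero => exact le_rfl
    | succ n ih =>
      have := hU _ (hpU n) (hp.1 (n + 1) n n.lt_succ_self)
      rw [Function.iterate_succ_apply']
      linarith [abs_nonneg (R (G^[n] p))]
  have hlim : Tendsto (fun n : ℕ => |R (G^[n] p)|) atTop (𝓝 0) := by
    have := ((continuous_abs.comp continuous_R).tendsto P₂).comp hp.2
    simpa [R_P₂, Function.comp_def] using this
  exact abs_nonpos_iff.1 (ge_of_tendsto' hlim hgrow)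

/-! ### The stable set -/

theorem iterate_mem_stableSet_iff {P p : ℝ × ℝ} {n : ℕ} (hn : IterateDefined n p) :
    G^[n] p ∈ stableSet P ↔ p ∈ stableSet P := by
  have hcomm : ∀ m : ℕ, G^[m] (G^[n] p) = G^[m + n] p := fun m =>
    (Function.iterate_add_apply G m n p).symm
  simp only [stableSet, Set.mem_ofPred_eq, hcomm, tendsto_add_atTop_iff_nat (f := fun m => G^[m] p)]
  refine and_congr_left fun _ => ⟨fun h m k hk => ?_, fun h m k hk => ?_⟩
  · rcases lt_or_ge k n with hkn | hkn
    · exact hn k hkn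
    · have := h (k - n + 1) (k - n) (Nat.lt_succ_self _)
      rwa [hcomm, Nat.sub_add_cancel hkn] at this
  · rw [hcomm]
    exact h (k + n + 1) (k + n) (Nat.lt_succ_self _)

theorem notMem_landsIn_of_mem_stableSet {P p : ℝ × ℝ} (hp : p ∈ stableSet P) :
    p ∉ landsIn {(-1, -1)} := by
  rintro ⟨n, -, hn⟩
  have hdom : G^[n] p ∈ domainG := hp.1 (n + 1) n n.lt_succ_self
  rw [Set.mem_singleton_iff.1 hn] at hdom
  exact hdom (by norm_num)

theorem mem_stableSet_of_mem_L₂ {p : ℝ × ℝ} (hp : p ∈ L₂) (hp1 : p ≠ (-1, -1)) :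
    p ∈ stableSet P₂ := by
  rw [L₂_eq_image] at hp
  obtain ⟨r, hr, rfl⟩ := hp
  refine doubleRootPoint_mem_stableSet hr ?_
  rintro rfl
  exact hp1 (by norm_num [doubleRootPoint])

theorem mem_stableSet_of_landsIn {p : ℝ × ℝ} (hp : p ∈ landsIn (R₁ ∩ C₁))
    (hp1 : p ∉ landsIn {(-1, -1)}) : p ∈ stableSet P₂ := by
  obtain ⟨n, hn, hmem⟩ := hp
  obtain ⟨hd, ha⟩ := mem_R₁_inter_C₁.1 hmem
  have hdom : G^[n] p ∈ domainG := by
    show (G^[n] p).1 + (G^[n] p).2 + 2 ≠ 0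
    linarith
  have hn' : IterateDefined (n + 1) p := by
    intro k hk
    rcases Nat.lt_succ_iff_lt_or_eq.1 hk with hk | rfl
    · exact hn k hk
    · exact hdom
  rw [← iterate_mem_stableSet_iff hn']
  refine mem_stableSet_of_mem_L₂ ?_ fun h => hp1 ⟨n + 1, hn', h⟩
  rw [Function.iterate_succ_apply', L₂_eq_image]
  have hpq : G^[n] p = ((G^[n] p).1, (G^[n] p).1) := Prod.ext rfl hd.symm
  rw [hpq, G_diagonal ha.ne]
  refine ⟨_, ?_, rfl⟩
  exact div_pos_of_neg_of_neg (by norm_num) (cbrt_neg_of_neg (by linarith))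

theorem mem_L₂_or_landsIn_of_iterate_mem_L₂ {p : ℝ × ℝ} (hp : ∀ n, IterateDefined n p) :
    ∀ n : ℕ, G^[n] p ∈ L₂ → p ∈ L₂ ∪ landsIn (R₁ ∩ C₁) := by
  intro n
  induction n with
  | zero => exact Or.inl
  | succ n ih =>
    intro h
    by_cases hL : G^[n] p ∈ L₂
    · exact ih hL
    · rw [Function.iterate_succ_apply'] at h
      exact Or.inr ⟨n, hp n, mem_R₁_inter_C₁_of_G_mem_L₂ (hp (n + 1) n n.lt_succ_self) hL h⟩

end

end Landen

theorem mainTheorem2 :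
    Landen.stableSet Landen.P₂ =
        (Landen.L₂ ∪ Landen.landsIn (Landen.R₁ ∩ Landen.C₁)) \ Landen.landsIn {(-1, -1)} ∧
      ∃ U ∈ 𝓝 Landen.P₂, ∀ V ∈ 𝓝 Landen.P₂, V ⊆ U →
        Landen.localStableManifold Landen.P₂ V ⊆ Landen.L₂ := by
  open Landen in
  obtain ⟨U, hU, hUexp⟩ := exists_nhds_expansion
  have hlocal : ∀ p ∈ stableSet P₂, (∀ n : ℕ, G^[n] p ∈ U) → p ∈ L₂ := by
    intro p hp hpU
    rw [L₂_eq_inter]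
    exact ⟨R_eq_zero_of_orbit_mem (fun q hq => (hUexp q hq).2) hp hpU, (hUexp p (hpU 0)).1⟩
  refine ⟨Set.Subset.antisymm ?_ ?_, U, hU, ?_⟩
  · intro p hp
    refine ⟨?_, notMem_landsIn_of_mem_stableSet hp⟩
    obtain ⟨N, hN⟩ := eventually_atTop.1 (hp.2.eventually hU)
    refine mem_L₂_or_landsIn_of_iterate_mem_L₂ hp.1 N (hlocal _ ?_ fun n => ?_)
    · exact (iterate_mem_stableSet_iff (hp.1 N)).2 hp
    · rw [← Function.iterate_add_apply]
      exact hN _ (Nat.le_add_left N n)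
  · rintro p ⟨hp | hp, hp1⟩
    · exact mem_stableSet_of_mem_L₂ hp fun h => hp1 ⟨0, fun k hk => absurd hk k.not_lt_zero, h⟩
    · exact mem_stableSet_of_landsIn hp hp1
  · rintro V - hVU p ⟨hp, hpV⟩
    exact hlocal p hp fun n => hVU (hpV n)
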